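/- Let $d\ge 0$ and let $\mu,\nu$ be Borel probability measures on $\mathbb{R}^d$ with finite second moments (not necessarily with densities). Put $$W_2^2(\mu,\nu)=\inf_{\pi\in\Pi(\mu,\nu)}\int \tfrac12\|x-y\|^2\,d\pi(x,y),$$ where $\Pi(\mu,\nu)$ is the set of couplings of $\mu$ and $\nu$. Let $F$ be a set of lower semicontinuous proper convex functions $f:\mathbb{R}^d\to(-\infty,+\infty]$, let $f^\star(y)=\sup_x[\langle x,y\rangle-f(x)]$ be the convex conjugate, and put $$W_{2,F}^2(\mu,\nu)=\int\tfrac12\|x\|^2\,d\mu+\int\tfrac12\|y\|^2\,d\nu-\inf_{f\in F}\Bigl[\int f\,d\mu+\int f^\star\,d\nu\Bigr]\in[-\infty,\infty).$$ $W_{2,F}(\mu,\nu)$ denotes the square root of this number (of its nonnegative part, should it be negative). Let $\nabla F\#\mu$ be the class of all push-forwards $T\#\mu$, where $T$ is measurable and, for some $f\in F$, $T(x)\in\partial f(x)$ for $\mu$-a.e. $x$. (i) If $\nu\in\nabla F\#\mu$, then $W_2^2(\mu,\nu)=W_{2,F}^2(\mu,\nu)$, hence $W_2(\mu,\nu)=W_{2,F}(\mu,\nu)$.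 (ii) Always $W_{2,F}^2(\mu,\nu)\le W_2^2(\mu,\nu)$, hence $W_{2,F}(\mu,\nu)\le W_2(\mu,\nu)$. Assume moreover that there are $c_1,c_2\ge0$ with $\|\nabla f^\star(x)-x\|\le c_1\|x\|+c_2$ for all $f\in F$ and all $x\in\mathbb{R}^d$ (if $f^\star$ is not differentiable at $x$, $\nabla f^\star(x)$ stands for some subgradient of $f^\star$ at $x$). Let $\lambda$ be a $W_2$-projection of $\nu$ onto $\nabla F\#\mu$, that is, a minimizer of $W_2(\nu,\cdot)$ over $\nabla F\#\mu$, with finite second moment. Let $\epsilon=W_2(\lambda,\nu)$ and $$c=\sqrt2\,\Bigl(\tfrac{c_1}{2}(\sigma_\nu+\sigma_\lambda)+c_2\Bigr),\qquad \sigma_\nu=\Bigl(\int\|x\|^2d\nu\Bigr)^{1/2},\quad \sigma_\lambda=\Bigl(\int\|x\|^2d\lambda\Bigr)^{1/2}.$$ Then $W_{2,F}^2(\mu,\nu)+c\,\epsilon\ge0$ and $$W_2(\mu,\nu)\le\bigl(W_{2,F}^2(\mu,\nu)+c\,\epsilon\bigr)^{1/2}+\epsilon .$$ -/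

import Mathlib

open MeasureTheory
open scoped ENNReal NNReal

noncomputable section

/-- The Euclidean space of dimension `d`. -/
abbrev RSpace (d : ℕ) := EuclideanSpace ℝ (Fin d)

/-! ### Convex analysis for extended-real-valued functions -/

/-- Lower semicontinuous proper convex functions with values in `(-∞, +∞]`;
convexity is convexity of the epigraph. -/
structure IsLscProperConvex {d : ℕ} (f : RSpace d → EReal) : Prop where
  convex_epigraph : Convex ℝ {p : RSpace d × ℝ | f p.1 ≤ (p.2 : EReal)}
  lsc : LowerSemicontinuous f
  ne_bot : ∀ x, f x ≠ ⊥
  exists_ne_top : ∃ x, f x ≠ ⊤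

/-- The convex conjugate `f⋆ y = sup_x (⟪x, y⟫ - f x)`. -/
def conjugate {d : ℕ} (f : RSpace d → EReal) (y : RSpace d) : EReal :=
  ⨆ x : RSpace d, ((inner ℝ x y : ℝ) : EReal) - f x

/-- The subdifferential `∂f x` (of a proper function `f`; it is empty where `f x = ⊤`). -/
def subdifferential {d : ℕ} (f : RSpace d → EReal) (x : RSpace d) : Set (RSpace d) :=
  {g | ∀ z : RSpace d, f x + ((inner ℝ g (z - x) : ℝ) : EReal) ≤ f z}

/-! ### Wasserstein distance -/

/-- `∫ ‖x‖² dμ`. -/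
def secondMoment {d : ℕ} (μ : Measure (RSpace d)) : ℝ≥0∞ :=
  ∫⁻ x, ‖x‖ₑ ^ 2 ∂μ

/-- The square root on `[0, ∞]`. -/
def esqrt (a : ℝ≥0∞) : ℝ≥0∞ := a ^ (1 / 2 : ℝ)

/-- The couplings of `μ` and `ν`: measures on the product with marginals `μ` and `ν`. -/
def couplings {d : ℕ} (μ ν : Measure (RSpace d)) : Set (Measure (RSpace d × RSpace d)) :=
  {π | π.map Prod.fst = μ ∧ π.map Prod.snd = ν}

/-- `W₂²(μ, ν) = inf_π ∫ ½ ‖x - y‖² dπ`, with the factor `½` in the cost. -/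
def W2Sq {d : ℕ} (μ ν : Measure (RSpace d)) : ℝ≥0∞ :=
  ⨅ π ∈ couplings μ ν, ∫⁻ p, ‖p.1 - p.2‖ₑ ^ 2 / 2 ∂π

/-- `W₂(μ, ν)`. -/
def W2 {d : ℕ} (μ ν : Measure (RSpace d)) : ℝ≥0∞ := esqrt (W2Sq μ ν)

/-! ### The restricted dual problem -/

/-- The integral of an extended-real-valued function, positive part minus negative part. -/
def eintegral {d : ℕ} (μ : Measure (RSpace d)) (g : RSpace d → EReal) : EReal :=
  ((∫⁻ x, (g x).toENNReal ∂μ : ℝ≥0∞) : EReal) - ((∫⁻ x, (-g x).toENNReal ∂μ : ℝ≥0∞) : EReal)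

/-- The dual objective `∫ f dμ + ∫ f⋆ dν`. -/
def dualObjective {d : ℕ} (μ ν : Measure (RSpace d)) (f : RSpace d → EReal) : EReal :=
  eintegral μ f + eintegral ν (conjugate f)

/-- `W²_{2,F}(μ, ν) = ∫ ½‖x‖² dμ + ∫ ½‖y‖² dν - inf_{f ∈ F} (∫ f dμ + ∫ f⋆ dν)`.
It is an extended real number, which may be negative when `F` is small. -/
def W2FSq {d : ℕ} (F : Set (RSpace d → EReal)) (μ ν : Measure (RSpace d)) : EReal :=
  ((secondMoment μ / 2 : ℝ≥0∞) : EReal) + ((secondMoment ν / 2 : ℝ≥0∞) : EReal)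
    - ⨅ f ∈ F, dualObjective μ ν f

/-- `W_{2,F}(μ, ν)`, the square root of the (nonnegative part of) `W²_{2,F}(μ, ν)`. -/
def W2F {d : ℕ} (F : Set (RSpace d → EReal)) (μ ν : Measure (RSpace d)) : ℝ≥0∞ :=
  esqrt (W2FSq F μ ν).toENNReal

/-- The class `∇F # μ` of all push-forwards `T # μ`, where `T` is measurable and
`T x ∈ ∂f x` for `μ`-almost every `x`, for some `f ∈ F`. -/
def gradPushforward {d : ℕ} (F : Set (RSpace d → EReal)) (μ : Measure (RSpace d)) :
    Set (Measure (RSpace d)) :=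
  {ρ | ∃ f ∈ F, ∃ T : RSpace d → RSpace d,
    Measurable T ∧ (∀ᵐ x ∂μ, T x ∈ subdifferential f x) ∧ ρ = μ.map T}

/-- The (set of) `W₂`-projections of `ν` onto a class `D`: the minimizers of `W₂(ν, ·)` on `D`. -/
def W2Proj {d : ℕ} (ν : Measure (RSpace d)) (D : Set (Measure (RSpace d))) :
    Set (Measure (RSpace d)) :=
  {ρ | ρ ∈ D ∧ ∀ ρ' ∈ D, W2 ν ρ ≤ W2 ν ρ'}

/-- `c = √2 (c₁ / 2 (σ_ν + σ_ρ) + c₂)` with `σ_ν = (∫ ‖x‖² dν)^{1/2}`, `σ_ρ = (∫ ‖x‖² dρ)^{1/2}`. -/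
def errorConst {d : ℕ} (c₁ c₂ : ℝ≥0) (ν ρ : Measure (RSpace d)) : ℝ≥0∞ :=
  esqrt 2 * ((c₁ : ℝ≥0∞) / 2 * (esqrt (secondMoment ν) + esqrt (secondMoment ρ)) + c₂)

end

/-! Integrating the Fenchel-Young inequality `⟪x, y⟫ ≤ f x + f⋆ y` against a coupling gives weak
duality, hence the lower bound (`W2FSq_le_W2Sq`). Equality holds when `y ∈ ∂f x`, so for a target `T
# μ` with `T x ∈ ∂f x` the coupling carried by the graph of `T` closes the gap (`W2Sq_map_eq`). This
is (i), and it shows that `T` is optimal.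

For the upper bound write the projection as `ρ = T # μ`. The triangle inequality
(`W2_le_esqrt_add_W2_map`) reduces the claim to bounding `W2Sq μ ρ`, which by (i) is the dual value
at `f`. The same `f` competes in the problem for `ν`; the `μ`-terms cancel and what remains is `∫ h
dρ - ∫ h dν` with `h = ‖·‖² / 2 - f⋆` (`W2FSq_map_le`). The growth condition says that the slope of
`h` at `x` is at most `c₁ ‖x‖ + c₂`; summing along a segment bounds increments of `h`
(`half_sq_sub_le`). Integrating over an arbitrary coupling of `ρ` and `ν`, applying Cauchy-Schwarz
and taking the infimum gives `c ε`. No optimal coupling of `ρ` and `ν` is needed. -/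

section

variable {d : ℕ}

/-! ### Convex conjugates and Fenchel-Young -/

/-- A proper lower semicontinuous convex function has an affine minorant. -/
lemma IsLscProperConvex.exists_affine_le {f : RSpace d → EReal} (hf : IsLscProperConvex f) :
    ∃ (a : RSpace d) (b : ℝ), ∀ x, ((inner ℝ x a - b : ℝ) : EReal) ≤ f x := by
  obtain ⟨x₀, hx₀⟩ := hf.exists_ne_top
  obtain ⟨r, hr⟩ : ∃ r : ℝ, (r : EReal) = f x₀ :=
    ⟨(f x₀).toReal, EReal.coe_toReal hx₀ (hf.ne_bot x₀)⟩
  have hclosed : IsClosed {p : RSpace d × ℝ | f p.1 ≤ (p.2 : EReal)} :=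
    hf.lsc.isClosed_epigraph.preimage
      (f := fun p : RSpace d × ℝ => (p.1, (p.2 : EReal)))
      (continuous_fst.prodMk (continuous_coe_real_ereal.comp continuous_snd))
  -- Separate the closed convex epigraph from a point directly below the graph; the point `(x₀, r)`
  -- above it forces a positive vertical coefficient `c`.
  have hnot : (x₀, r - 1) ∉ {p : RSpace d × ℝ | f p.1 ≤ (p.2 : EReal)} := by
    simp only [Set.mem_ofPred_eq, ← hr, EReal.coe_le_coe_iff]
    linarith
  obtain ⟨φ, u, hu, hφ⟩ := geometric_hahn_banach_point_closed hf.convex_epigraph hclosed hnot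
  have hdec : ∀ (x : RSpace d) (t : ℝ), φ (x, t) = φ (x, 0) + t * φ (0, 1) := by
    intro x t
    have : (x, t) = (x, (0 : ℝ)) + t • ((0 : RSpace d), (1 : ℝ)) := by simp
    rw [this, map_add, map_smul, smul_eq_mul]
  have hc : 0 < φ (0, 1) := by
    have h := hu.trans (hφ (x₀, r) (by simp [hr]))
    rw [hdec x₀ r, hdec x₀ (r - 1)] at h
    linarith
  set c := φ (0, 1) with hcdef
  let ψ : RSpace d →L[ℝ] ℝ := φ.comp (ContinuousLinearMap.inl ℝ (RSpace d) ℝ)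
  let w : RSpace d := (InnerProductSpace.toDual ℝ (RSpace d)).symm ψ
  have hw : ∀ x, inner ℝ x w = φ (x, 0) := by
    intro x
    rw [real_inner_comm]
    simp [w, ψ]
  -- Solve `u < φ (x, 0) + t * c` for `t`.
  refine ⟨(-c⁻¹) • w, -(u / c), fun x => ?_⟩
  rw [inner_smul_right, hw]
  induction hfx : f x with
  | bot => exact absurd hfx (hf.ne_bot x)
  | top => exact le_top
  | coe t =>
    have h := hφ (x, t) (by simp [hfx])
    rw [hdec] at h
    rw [EReal.coe_le_coe_iff]
    have : u / c < (φ (x, 0) + t * c) / c := by gcongr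
    rw [add_div, mul_div_cancel_right₀ _ hc.ne'] at this
    rw [neg_mul, inv_mul_eq_div]
    linarith

lemma inner_sub_le_conjugate (f : RSpace d → EReal) (x y : RSpace d) :
    ((inner ℝ x y : ℝ) : EReal) - f x ≤ conjugate f y :=
  le_iSup (fun x : RSpace d => ((inner ℝ x y : ℝ) : EReal) - f x) x

/-- One point of the domain of `f` already gives a term of the supremum that is affine in `y`. -/
lemma IsLscProperConvex.exists_affine_le_conjugate {f : RSpace d → EReal}
    (hf : IsLscProperConvex f) :
    ∃ (a : RSpace d) (b : ℝ), ∀ y, ((inner ℝ y a - b : ℝ) : EReal) ≤ conjugate f y := by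
  obtain ⟨x₀, hx₀⟩ := hf.exists_ne_top
  refine ⟨x₀, (f x₀).toReal, fun y => ?_⟩
  have h := inner_sub_le_conjugate f x₀ y
  rwa [← EReal.coe_toReal hx₀ (hf.ne_bot x₀), ← EReal.coe_sub, real_inner_comm] at h

lemma IsLscProperConvex.conjugate_ne_bot {f : RSpace d → EReal} (hf : IsLscProperConvex f)
    (y : RSpace d) : conjugate f y ≠ ⊥ := by
  obtain ⟨a, b, h⟩ := hf.exists_affine_le_conjugate
  exact fun h' => (EReal.bot_lt_coe _).not_ge (h' ▸ h y)

/-- The slope of an affine minorant of `f` is a point where the supremum is finite. -/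
lemma IsLscProperConvex.exists_conjugate_ne_top {f : RSpace d → EReal}
    (hf : IsLscProperConvex f) : ∃ y, conjugate f y ≠ ⊤ := by
  obtain ⟨a, b, h⟩ := hf.exists_affine_le
  refine ⟨a, ne_top_of_le_ne_top (EReal.coe_ne_top b) (iSup_le fun x => ?_)⟩
  have hx := h x
  induction hfx : f x with
  | bot => exact absurd hfx (hf.ne_bot x)
  | top => simp
  | coe t =>
    rw [hfx, EReal.coe_le_coe_iff] at hx
    rw [← EReal.coe_sub, EReal.coe_le_coe_iff]
    linarith

lemma IsLscProperConvex.lowerSemicontinuous_conjugate {f : RSpace d → EReal}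
    (hf : IsLscProperConvex f) : LowerSemicontinuous (conjugate f) := by
  refine lowerSemicontinuous_iSup fun x => Continuous.lowerSemicontinuous ?_
  induction hfx : f x with
  | bot => exact absurd hfx (hf.ne_bot x)
  | top => simpa using continuous_const
  | coe t =>
    simp only [← EReal.coe_sub]
    exact continuous_coe_real_ereal.comp (by fun_prop)

lemma IsLscProperConvex.inner_le_toReal_add {f : RSpace d → EReal} (hf : IsLscProperConvex f)
    {x y : RSpace d} (hx : f x ≠ ⊤) (hy : conjugate f y ≠ ⊤) :
    inner ℝ x y ≤ (f x).toReal + (conjugate f y).toReal := by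
  have h := inner_sub_le_conjugate f x y
  rw [← EReal.coe_toReal hx (hf.ne_bot x), ← EReal.coe_toReal hy (hf.conjugate_ne_bot y),
    ← EReal.coe_sub, EReal.coe_le_coe_iff] at h
  linarith

lemma ne_top_of_mem_subdifferential {f : RSpace d → EReal} (h : ∃ x, f x ≠ ⊤)
    {x g : RSpace d} (hg : g ∈ subdifferential f x) : f x ≠ ⊤ := by
  rintro hx
  obtain ⟨z, hz⟩ := h
  have := hg z
  rw [hx, EReal.top_add_coe, top_le_iff] at this
  exact hz this

/-- Equality in the Fenchel-Young inequality. -/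
lemma IsLscProperConvex.conjugate_eq {f : RSpace d → EReal} (hf : IsLscProperConvex f)
    {x g : RSpace d} (hg : g ∈ subdifferential f x) :
    conjugate f g = ((inner ℝ x g - (f x).toReal : ℝ) : EReal) := by
  have hx := ne_top_of_mem_subdifferential hf.exists_ne_top hg
  have hfx := EReal.coe_toReal hx (hf.ne_bot x)
  refine le_antisymm (iSup_le fun z => ?_) ?_
  · have hz := hg z
    rw [← hfx, ← EReal.coe_add] at hz
    induction hfz : f z with
    | bot => exact absurd hfz (hf.ne_bot z)
    | top => simp
    | coe t =>
      rw [hfz, EReal.coe_le_coe_iff, inner_sub_right, real_inner_comm x g,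
        real_inner_comm z g] at hz
      rw [← EReal.coe_sub, EReal.coe_le_coe_iff]
      linarith
  · have h := inner_sub_le_conjugate f x g
    rwa [← hfx, ← EReal.coe_sub] at h

/-! ### Increments of `‖x‖² / 2 - f x` along segments -/

/-- A real function whose increments are bounded above by a multiple of the squared step
is nonincreasing. -/
lemma le_of_sub_le_mul_sq {ψ : ℝ → ℝ} {C : ℝ}
    (h : ∀ s t, 0 ≤ s → s ≤ t → t ≤ 1 → ψ t - ψ s ≤ C * (t - s) ^ 2) : ψ 1 ≤ ψ 0 := by
  -- With `n + 1` equal steps the squared errors add up to `C / (n + 1)`.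
  have key : ∀ n : ℕ, ψ 1 - ψ 0 ≤ C * (1 / ((n : ℝ) + 1)) := by
    intro n
    have hn : (0 : ℝ) < n + 1 := by positivity
    have hsum := Finset.sum_range_sub (fun k : ℕ => ψ ((k : ℝ) / (n + 1))) (n + 1)
    have h1 : ((n + 1 : ℕ) : ℝ) / (n + 1) = 1 := by push_cast; field_simp
    simp only [h1, Nat.cast_zero, zero_div] at hsum
    rw [← hsum]
    calc _ ≤ ∑ k ∈ Finset.range (n + 1), C * (1 / ((n : ℝ) + 1)) ^ 2 := by
          refine Finset.sum_le_sum fun k hk => ?_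
          have hk' : ((k + 1 : ℕ) : ℝ) ≤ n + 1 := by
            exact_mod_cast Finset.mem_range.1 hk
          refine (h _ _ (by positivity) (by gcongr; simp) ((div_le_one hn).2 hk')).trans_eq ?_
          push_cast
          ring
      _ = _ := by
          rw [Finset.sum_const, Finset.card_range, nsmul_eq_mul]
          push_cast
          field_simp
  have hlim := (tendsto_one_div_add_atTop_nhds_zero_nat (𝕜 := ℝ)).const_mul C
  rw [mul_zero] at hlim
  linarith [ge_of_tendsto' hlim key]

/-- If `f` is subdifferentiable everywhere with subgradients at distance at most `c₁ ‖x‖ + c₂`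
from `x`, then `‖x‖² / 2 - f x` is Lipschitz with the trapezoidal local constant. -/
lemma half_sq_sub_le {f : RSpace d → ℝ} {c₁ c₂ : ℝ} (hc₁ : 0 ≤ c₁)
    (h : ∀ x, ∃ g : RSpace d, (∀ z, f x + inner ℝ g (z - x) ≤ f z) ∧
      ‖g - x‖ ≤ c₁ * ‖x‖ + c₂) (x y : RSpace d) :
    (‖x‖ ^ 2 / 2 - f x) - (‖y‖ ^ 2 / 2 - f y)
      ≤ (c₁ / 2 * (‖x‖ + ‖y‖) + c₂) * ‖x - y‖ := by
  set N := ‖x - y‖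
  set γ : ℝ → RSpace d := fun t => y + t • (x - y)
  -- `M` is the primitive, vanishing at `0`, of `N * (c₁ * ((1 - s) * ‖y‖ + s * ‖x‖) + c₂)`; `M 1`
  -- is the trapezoidal bound.
  set M : ℝ → ℝ := fun t => N * (c₁ * ((t - t ^ 2 / 2) * ‖y‖ + t ^ 2 / 2 * ‖x‖) + c₂ * t)
  have key : ‖γ 1‖ ^ 2 / 2 - f (γ 1) - M 1 ≤ ‖γ 0‖ ^ 2 / 2 - f (γ 0) - M 0 := by
    refine le_of_sub_le_mul_sq (ψ := fun t => ‖γ t‖ ^ 2 / 2 - f (γ t) - M t)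
      -- The first term is the quadratic remainder of `‖·‖² / 2`, the second bounds that of `-M`,
      -- whose `‖x‖` part has a favourable sign (`h7`).
      (C := N ^ 2 / 2 + N * c₁ * ‖y‖ / 2) fun s t hs hst ht => ?_
    obtain ⟨g, hg, hgn⟩ := h (γ s)
    have hγ : γ t - γ s = (t - s) • (x - y) := by simp only [γ]; module
    have h1 := hg (γ t)
    have h2 : ‖γ t‖ ^ 2 = ‖γ s‖ ^ 2 + 2 * inner ℝ (γ s) (γ t - γ s) + ‖γ t - γ s‖ ^ 2 := by
      rw [← norm_add_sq_real]; simp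
    have h3 : ‖γ t - γ s‖ = (t - s) * N := by
      rw [hγ, norm_smul, Real.norm_of_nonneg (by linarith)]
    have h4 : inner ℝ (γ s) (γ t - γ s) - inner ℝ g (γ t - γ s) ≤
        (c₁ * ‖γ s‖ + c₂) * ((t - s) * N) := by
      rw [← inner_sub_left, ← h3]
      refine (real_inner_le_norm _ _).trans ?_
      gcongr
      rwa [norm_sub_rev]
    have h5 : ‖γ s‖ ≤ (1 - s) * ‖y‖ + s * ‖x‖ := by
      have : γ s = (1 - s) • y + s • x := by simp only [γ]; module
      rw [this]
      refine (norm_add_le _ _).trans_eq ?_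
      rw [norm_smul, norm_smul, Real.norm_of_nonneg hs, Real.norm_of_nonneg (by linarith)]
    have hN : 0 ≤ N := norm_nonneg _
    have h6 : (c₁ * ‖γ s‖ + c₂) * ((t - s) * N) ≤
        (c₁ * ((1 - s) * ‖y‖ + s * ‖x‖) + c₂) * ((t - s) * N) := by
      have : 0 ≤ t - s := by linarith
      gcongr
    have h7 : 0 ≤ N * c₁ * ‖x‖ * (t - s) ^ 2 := by positivity
    rw [h3] at h2
    simp only [M]
    nlinarith
  have e1 : γ 1 = x := by simp [γ]
  have e0 : γ 0 = y := by simp [γ]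
  simp only [e1, e0, M] at key
  linarith

/-! ### Extended-real integrals and second moments -/

lemma eintegral_eq_integral {μ : Measure (RSpace d)} {g : RSpace d → EReal} {u : RSpace d → ℝ}
    (hg : ∀ᵐ x ∂μ, g x = u x) (hu : Integrable u μ) :
    eintegral μ g = ((∫ x, u x ∂μ : ℝ) : EReal) := by
  have h1 : ∫⁻ x, (g x).toENNReal ∂μ = ∫⁻ x, ENNReal.ofReal (u x) ∂μ :=
    lintegral_congr_ae (hg.mono fun x hx => by simp [hx])
  have h2 : ∫⁻ x, (-g x).toENNReal ∂μ = ∫⁻ x, ENNReal.ofReal (-u x) ∂μ :=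
    lintegral_congr_ae (hg.mono fun x hx => by
      dsimp only
      rw [hx, ← EReal.coe_neg, EReal.real_coe_toENNReal])
  rw [eintegral, h1, h2, integral_eq_lintegral_pos_part_sub_lintegral_neg_part hu, EReal.coe_sub,
    EReal.coe_ennreal_toReal hu.lintegral_lt_top.ne]
  congr 1
  exact (EReal.coe_ennreal_toReal hu.neg.lintegral_lt_top.ne).symm

/-- The integrable minorant makes the negative part finite, so `∞ - ∞` cannot occur. -/
lemma eintegral_eq_top_or_integrable {μ : Measure (RSpace d)} {g : RSpace d → EReal}
    {u : RSpace d → ℝ} (hg : Measurable g) (hu : Integrable u μ) (hug : ∀ x, (u x : EReal) ≤ g x) :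
    eintegral μ g = ⊤ ∨ ((∀ᵐ x ∂μ, g x ≠ ⊤) ∧ Integrable (fun x => (g x).toReal) μ) := by
  have hneg : ∫⁻ x, (-g x).toENNReal ∂μ ≠ ⊤ := by
    refine ne_top_of_le_ne_top hu.neg.lintegral_lt_top.ne (lintegral_mono fun x => ?_)
    have := EReal.toENNReal_le_toENNReal (EReal.neg_le_neg_iff.2 (hug x))
    rwa [← EReal.coe_neg, EReal.real_coe_toENNReal] at this
  by_cases hpos : ∫⁻ x, (g x).toENNReal ∂μ = ⊤
  · left
    rw [eintegral, hpos, ← EReal.coe_ennreal_toReal hneg, EReal.coe_ennreal_top,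
      EReal.top_sub_coe]
  · right
    have hmeas : Measurable fun x => (g x).toENNReal := hg.ereal_toENNReal
    have hae : ∀ᵐ x ∂μ, g x ≠ ⊤ :=
      (ae_lt_top hmeas hpos).mono fun x hx => EReal.toENNReal_ne_top_iff.1 hx.ne
    refine ⟨hae, hg.ereal_toReal.aestronglyMeasurable, ?_⟩
    have hsum : ∫⁻ x, ((g x).toENNReal + (-g x).toENNReal) ∂μ < ⊤ := by
      rw [lintegral_add_left hmeas]
      exact ENNReal.add_lt_top.2 ⟨lt_top_iff_ne_top.2 hpos, lt_top_iff_ne_top.2 hneg⟩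
    refine (lintegral_mono_ae (hae.mono fun x hx => ?_)).trans_lt hsum
    have hbot : g x ≠ ⊥ := fun h => (EReal.bot_lt_coe _).not_ge (h ▸ hug x)
    rw [← EReal.coe_toReal hx hbot, ← EReal.coe_neg, EReal.real_coe_toENNReal,
      EReal.real_coe_toENNReal, Real.enorm_eq_ofReal_abs]
    rcases abs_cases (g x).toReal with ⟨h, -⟩ | ⟨h, -⟩ <;> rw [h]
    · exact le_self_add
    · exact le_add_self

lemma enorm_sq_eq_ofReal (x : RSpace d) : ‖x‖ₑ ^ 2 = ENNReal.ofReal (‖x‖ ^ 2) := by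
  rw [ENNReal.ofReal_pow (norm_nonneg _), ofReal_norm]

lemma integrable_norm_sq {μ : Measure (RSpace d)} (hμ : secondMoment μ ≠ ⊤) :
    Integrable (fun x => ‖x‖ ^ 2) μ := by
  refine ⟨by fun_prop, ?_⟩
  refine lt_of_eq_of_lt (lintegral_congr fun x => ?_) (lt_top_iff_ne_top.2 hμ)
  rw [enorm_sq_eq_ofReal, Real.enorm_of_nonneg (by positivity)]

lemma secondMoment_eq_ofReal {μ : Measure (RSpace d)} (hμ : secondMoment μ ≠ ⊤) :
    secondMoment μ = ENNReal.ofReal (∫ x, ‖x‖ ^ 2 ∂μ) := by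
  rw [ofReal_integral_eq_lintegral_ofReal (integrable_norm_sq hμ)
    (Filter.Eventually.of_forall fun x => by positivity)]
  simp only [secondMoment, enorm_sq_eq_ofReal]

lemma coe_half_secondMoment {μ : Measure (RSpace d)} (hμ : secondMoment μ ≠ ⊤) :
    ((secondMoment μ / 2 : ℝ≥0∞) : EReal) = (((∫ x, ‖x‖ ^ 2 ∂μ) / 2 : ℝ) : EReal) := by
  have h : 0 ≤ ∫ x, ‖x‖ ^ 2 ∂μ := integral_nonneg fun x => by positivity
  have h2 := ENNReal.ofReal_div_of_pos (x := ∫ x, ‖x‖ ^ 2 ∂μ) two_pos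
  rw [ENNReal.ofReal_ofNat] at h2
  rw [secondMoment_eq_ofReal hμ, ← h2, EReal.coe_ennreal_ofReal, max_eq_left (by positivity)]

lemma integrable_norm {μ : Measure (RSpace d)} [IsFiniteMeasure μ] (hμ : secondMoment μ ≠ ⊤) :
    Integrable (fun x => ‖x‖) μ := by
  refine ((integrable_norm_sq hμ).add (integrable_const 1)).mono' (by fun_prop)
    (Filter.Eventually.of_forall fun x => ?_)
  simp only [norm_norm, Pi.add_apply]
  nlinarith [sq_nonneg (‖x‖ - 1)]

lemma integrable_inner_sub {μ : Measure (RSpace d)} [IsFiniteMeasure μ]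
    (hμ : secondMoment μ ≠ ⊤) (a : RSpace d) (b : ℝ) :
    Integrable (fun x => inner ℝ x a - b) μ := by
  refine Integrable.sub ?_ (integrable_const b)
  refine ((integrable_norm hμ).mul_const ‖a‖).mono' (by fun_prop)
    (Filter.Eventually.of_forall fun x => norm_inner_le_norm x a)

/-! ### Integrals against couplings -/

section Coupling

variable {μ ν : Measure (RSpace d)} {π : Measure (RSpace d × RSpace d)}

lemma integral_fst_of_mem_couplings (hπ : π ∈ couplings μ ν) {u : RSpace d → ℝ}
    (hu : Integrable u μ) : Integrable (fun p => u p.1) π ∧ ∫ p, u p.1 ∂π = ∫ x, u x ∂μ := by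
  obtain ⟨rfl, -⟩ := hπ
  exact ⟨hu.comp_measurable measurable_fst,
    (integral_map measurable_fst.aemeasurable hu.aestronglyMeasurable).symm⟩

lemma integral_snd_of_mem_couplings (hπ : π ∈ couplings μ ν) {u : RSpace d → ℝ}
    (hu : Integrable u ν) : Integrable (fun p => u p.2) π ∧ ∫ p, u p.2 ∂π = ∫ x, u x ∂ν := by
  obtain ⟨-, rfl⟩ := hπ
  exact ⟨hu.comp_measurable measurable_snd,
    (integral_map measurable_snd.aemeasurable hu.aestronglyMeasurable).symm⟩

lemma ae_fst_of_mem_couplings (hπ : π ∈ couplings μ ν) {p : RSpace d → Prop}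
    (h : ∀ᵐ x ∂μ, p x) : ∀ᵐ q ∂π, p q.1 := by
  obtain ⟨rfl, -⟩ := hπ
  exact ae_of_ae_map measurable_fst.aemeasurable h

lemma ae_snd_of_mem_couplings (hπ : π ∈ couplings μ ν) {p : RSpace d → Prop}
    (h : ∀ᵐ x ∂ν, p x) : ∀ᵐ q ∂π, p q.2 := by
  obtain ⟨-, rfl⟩ := hπ
  exact ae_of_ae_map measurable_snd.aemeasurable h

lemma integrable_inner_of_mem_couplings (hπ : π ∈ couplings μ ν) (hμ : secondMoment μ ≠ ⊤)
    (hν : secondMoment ν ≠ ⊤) : Integrable (fun p => inner ℝ p.1 p.2) π := by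
  have h1 := (integral_fst_of_mem_couplings hπ (integrable_norm_sq hμ)).1
  have h2 := (integral_snd_of_mem_couplings hπ (integrable_norm_sq hν)).1
  refine (h1.add h2).mono' (by fun_prop) (Filter.Eventually.of_forall fun p => ?_)
  refine (norm_inner_le_norm _ _).trans ?_
  simp only [Pi.add_apply]
  nlinarith [sq_nonneg (‖p.1‖ - ‖p.2‖), sq_nonneg (‖p.1‖ + ‖p.2‖)]

lemma integral_half_sq_of_mem_couplings (hπ : π ∈ couplings μ ν) (hμ : secondMoment μ ≠ ⊤)
    (hν : secondMoment ν ≠ ⊤) :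
    Integrable (fun p => ‖p.1 - p.2‖ ^ 2 / 2) π ∧ ∫ p, ‖p.1 - p.2‖ ^ 2 / 2 ∂π =
      (∫ x, ‖x‖ ^ 2 ∂μ) / 2 + (∫ x, ‖x‖ ^ 2 ∂ν) / 2 - ∫ p, inner ℝ p.1 p.2 ∂π := by
  obtain ⟨h1, e1⟩ := integral_fst_of_mem_couplings hπ (integrable_norm_sq hμ)
  obtain ⟨h2, e2⟩ := integral_snd_of_mem_couplings hπ (integrable_norm_sq hν)
  have h3 := integrable_inner_of_mem_couplings hπ hμ hν
  have heq : (fun p : RSpace d × RSpace d => ‖p.1 - p.2‖ ^ 2 / 2) =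
      fun p => ‖p.1‖ ^ 2 / 2 + ‖p.2‖ ^ 2 / 2 - inner ℝ p.1 p.2 := by
    ext p
    rw [norm_sub_sq_real]
    ring
  have h4 : Integrable (fun p : RSpace d × RSpace d => ‖p.1‖ ^ 2 / 2 + ‖p.2‖ ^ 2 / 2) π :=
    (h1.div_const 2).add (h2.div_const 2)
  rw [heq]
  refine ⟨h4.sub h3, ?_⟩
  rw [integral_sub h4 h3, integral_add (h1.div_const 2) (h2.div_const 2), integral_div,
    integral_div, e1, e2]

lemma lintegral_cost_of_mem_couplings (hπ : π ∈ couplings μ ν) (hμ : secondMoment μ ≠ ⊤)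
    (hν : secondMoment ν ≠ ⊤) :
    ((∫⁻ p, ‖p.1 - p.2‖ₑ ^ 2 / 2 ∂π : ℝ≥0∞) : EReal) =
      (((∫ x, ‖x‖ ^ 2 ∂μ) / 2 + (∫ x, ‖x‖ ^ 2 ∂ν) / 2 - ∫ p, inner ℝ p.1 p.2 ∂π : ℝ) : EReal) := by
  obtain ⟨h, e⟩ := integral_half_sq_of_mem_couplings hπ hμ hν
  have h0 : 0 ≤ ∫ p, ‖p.1 - p.2‖ ^ 2 / 2 ∂π := integral_nonneg fun p => by positivity
  rw [← e, ← max_eq_left h0, ← EReal.coe_ennreal_ofReal,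
    ofReal_integral_eq_lintegral_ofReal h (Filter.Eventually.of_forall fun p => by positivity)]
  congr 1
  refine lintegral_congr fun p => ?_
  rw [enorm_sq_eq_ofReal, ENNReal.ofReal_div_of_pos two_pos, ENNReal.ofReal_ofNat]

end Coupling

/-! ### Weak duality and its equality case -/

/-- Weak duality. -/
lemma IsLscProperConvex.integral_inner_le_dualObjective {μ ν : Measure (RSpace d)}
    [IsFiniteMeasure μ] [IsFiniteMeasure ν] (hμ : secondMoment μ ≠ ⊤) (hν : secondMoment ν ≠ ⊤)
    {f : RSpace d → EReal} (hf : IsLscProperConvex f) {π : Measure (RSpace d × RSpace d)}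
    (hπ : π ∈ couplings μ ν) :
    ((∫ p, inner ℝ p.1 p.2 ∂π : ℝ) : EReal) ≤ dualObjective μ ν f := by
  obtain ⟨a, b, hab⟩ := hf.exists_affine_le
  obtain ⟨a', b', hab'⟩ := hf.exists_affine_le_conjugate
  have hne : ∀ x, f x ≠ ⊤ → f x = ((f x).toReal : EReal) := fun x hx =>
    (EReal.coe_toReal hx (hf.ne_bot x)).symm
  have hne' : ∀ x, conjugate f x ≠ ⊤ → conjugate f x = ((conjugate f x).toReal : EReal) :=
    fun x hx => (EReal.coe_toReal hx (hf.conjugate_ne_bot x)).symm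
  -- If either integral is `⊤`, the other is not `⊥`, so the bound is trivial; otherwise everything
  -- is real-valued.
  rcases eintegral_eq_top_or_integrable hf.lsc.measurable (integrable_inner_sub hμ a b) hab with
    h1 | ⟨h1, i1⟩ <;>
  rcases eintegral_eq_top_or_integrable hf.lowerSemicontinuous_conjugate.measurable
    (integrable_inner_sub hν a' b') hab' with h2 | ⟨h2, i2⟩
  · simp [dualObjective, h1, h2]
  · rw [dualObjective, h1, eintegral_eq_integral (h2.mono hne') i2, EReal.top_add_coe]
    exact le_top
  · rw [dualObjective, h2, eintegral_eq_integral (h1.mono hne) i1, EReal.coe_add_top]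
    exact le_top
  · rw [dualObjective, eintegral_eq_integral (h1.mono hne) i1,
      eintegral_eq_integral (h2.mono hne') i2, ← EReal.coe_add, EReal.coe_le_coe_iff]
    obtain ⟨j1, e1⟩ := integral_fst_of_mem_couplings hπ i1
    obtain ⟨j2, e2⟩ := integral_snd_of_mem_couplings hπ i2
    rw [← e1, ← e2, ← integral_add j1 j2]
    refine integral_mono_ae (integrable_inner_of_mem_couplings hπ hμ hν) (j1.add j2) ?_
    filter_upwards [ae_fst_of_mem_couplings hπ h1, ae_snd_of_mem_couplings hπ h2] with p hp1 hp2
    exact hf.inner_le_toReal_add hp1 hp2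

lemma W2FSq_le_W2Sq {F : Set (RSpace d → EReal)} (hF : ∀ f ∈ F, IsLscProperConvex f)
    {μ ν : Measure (RSpace d)} [IsFiniteMeasure μ] [IsFiniteMeasure ν]
    (hμ : secondMoment μ ≠ ⊤) (hν : secondMoment ν ≠ ⊤) :
    W2FSq F μ ν ≤ (W2Sq μ ν : EReal) := by
  -- Truncating at `0` allows the infimum over couplings to be taken in `ℝ≥0∞`; the untruncated
  -- value is only smaller.
  have key : (W2FSq F μ ν).toENNReal ≤ W2Sq μ ν := by
    refine le_iInf₂ fun π hπ => ?_
    rw [← EReal.toENNReal_coe (x := ∫⁻ p, ‖p.1 - p.2‖ₑ ^ 2 / 2 ∂π)]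
    refine EReal.toENNReal_le_toENNReal ?_
    rw [lintegral_cost_of_mem_couplings hπ hμ hν, W2FSq, coe_half_secondMoment hμ,
      coe_half_secondMoment hν, EReal.coe_sub, EReal.coe_add]
    exact EReal.sub_le_sub le_rfl
      (le_iInf₂ fun f hf => (hF f hf).integral_inner_le_dualObjective hμ hν hπ)
  calc W2FSq F μ ν ≤ max 0 (W2FSq F μ ν) := le_max_right _ _
    _ = ((W2FSq F μ ν).toENNReal : EReal) := EReal.coe_toENNReal_eq_max.symm
    _ ≤ _ := EReal.coe_ennreal_le_coe_ennreal_iff.2 key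

section Transport

variable {μ ν : Measure (RSpace d)} {T : RSpace d → RSpace d}

lemma map_prodMk_mem_couplings (hT : Measurable T) :
    μ.map (fun x => (x, T x)) ∈ couplings μ (μ.map T) := by
  have h : Measurable fun x => (x, T x) := measurable_id.prodMk hT
  exact ⟨by rw [Measure.map_map measurable_fst h]; exact Measure.map_id,
    by rw [Measure.map_map measurable_snd h]; rfl⟩

/-- Complementary slackness: if `T x ∈ ∂f x` almost everywhere, then `f` and its conjugate are
integrable for `μ` and `T # μ`, and attain equality in weak duality. -/
lemma IsLscProperConvex.integrable_of_mem_subdifferential [IsFiniteMeasure μ]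
    (hμ : secondMoment μ ≠ ⊤) (hT : Measurable T) (hρ : secondMoment (μ.map T) ≠ ⊤)
    {f : RSpace d → EReal} (hf : IsLscProperConvex f)
    (hfT : ∀ᵐ x ∂μ, T x ∈ subdifferential f x) :
    (∀ᵐ x ∂μ, f x ≠ ⊤) ∧ Integrable (fun x => (f x).toReal) μ ∧
    (∀ᵐ y ∂μ.map T, conjugate f y ≠ ⊤) ∧
    Integrable (fun y => (conjugate f y).toReal) (μ.map T) ∧
    ∫ x, (f x).toReal ∂μ + ∫ y, (conjugate f y).toReal ∂μ.map T = ∫ x, inner ℝ x (T x) ∂μ := by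
  obtain ⟨a, b, hab⟩ := hf.exists_affine_le
  obtain ⟨a', b', hab'⟩ := hf.exists_affine_le_conjugate
  have hmeas := hf.lsc.measurable
  have hmeas' := hf.lowerSemicontinuous_conjugate.measurable
  have hinner : Integrable (fun x => inner ℝ x (T x)) μ :=
    (integrable_inner_of_mem_couplings (map_prodMk_mem_couplings hT) hμ hρ).comp_measurable
      (measurable_id.prodMk hT)
  have hlow' : Integrable (fun x => inner ℝ (T x) a' - b') μ :=
    (integrable_inner_sub hρ a' b').comp_measurable hT
  have hne : ∀ᵐ x ∂μ, f x ≠ ⊤ :=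
    hfT.mono fun x hx => ne_top_of_mem_subdifferential hf.exists_ne_top hx
  have hi : Integrable (fun x => (f x).toReal) μ := by
    -- By equality in Fenchel-Young, an affine minorant of `f⋆` at `T x` becomes an upper bound for
    -- `f x`.
    refine integrable_of_le_of_le hmeas.ereal_toReal.aestronglyMeasurable
      (g₁ := fun x => inner ℝ x a - b)
      (g₂ := fun x => inner ℝ x (T x) - (inner ℝ (T x) a' - b')) ?_ ?_
      (integrable_inner_sub hμ a b) (hinner.sub hlow')
    · filter_upwards [hne] with x hx
      have h := hab x
      rwa [← EReal.coe_toReal hx (hf.ne_bot x), EReal.coe_le_coe_iff] at h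
    · filter_upwards [hfT] with x hx
      have h := hab' (T x)
      rw [hf.conjugate_eq hx, EReal.coe_le_coe_iff] at h
      linarith
  have hae : (fun x => (conjugate f (T x)).toReal) =ᵐ[μ]
      fun x => inner ℝ x (T x) - (f x).toReal := by
    filter_upwards [hfT] with x hx
    rw [hf.conjugate_eq hx, EReal.toReal_coe]
  have hi' : Integrable (fun y => (conjugate f y).toReal) (μ.map T) := by
    rw [integrable_map_measure hmeas'.ereal_toReal.aestronglyMeasurable hT.aemeasurable]
    exact (hinner.sub hi).congr hae.symm
  refine ⟨hne, hi, ?_, hi', ?_⟩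
  · refine (ae_map_iff hT.aemeasurable (hmeas' (measurableSet_singleton ⊤).compl)).2 ?_
    filter_upwards [hfT] with x hx
    rw [hf.conjugate_eq hx]
    exact EReal.coe_ne_top _
  · rw [integral_map hT.aemeasurable hmeas'.ereal_toReal.aestronglyMeasurable,
      integral_congr_ae hae, integral_sub hinner hi]
    ring

lemma dualObjective_eq_integral {f : RSpace d → EReal} (hf : IsLscProperConvex f)
    (hμ : ∀ᵐ x ∂μ, f x ≠ ⊤) (iμ : Integrable (fun x => (f x).toReal) μ)
    (hν : ∀ᵐ y ∂ν, conjugate f y ≠ ⊤) (iν : Integrable (fun y => (conjugate f y).toReal) ν) :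
    dualObjective μ ν f =
      ((∫ x, (f x).toReal ∂μ + ∫ y, (conjugate f y).toReal ∂ν : ℝ) : EReal) := by
  rw [dualObjective, eintegral_eq_integral (hμ.mono fun x hx =>
      (EReal.coe_toReal hx (hf.ne_bot x)).symm) iμ,
    eintegral_eq_integral (hν.mono fun x hx =>
      (EReal.coe_toReal hx (hf.conjugate_ne_bot x)).symm) iν, EReal.coe_add]

lemma le_W2FSq {F : Set (RSpace d → EReal)} {f : RSpace d → EReal} (hfF : f ∈ F)
    (hμ : secondMoment μ ≠ ⊤) (hν : secondMoment ν ≠ ⊤) {r : ℝ}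
    (hr : dualObjective μ ν f = (r : EReal)) :
    (((∫ x, ‖x‖ ^ 2 ∂μ) / 2 + (∫ x, ‖x‖ ^ 2 ∂ν) / 2 - r : ℝ) : EReal) ≤ W2FSq F μ ν := by
  rw [W2FSq, coe_half_secondMoment hμ, coe_half_secondMoment hν, EReal.coe_sub, EReal.coe_add]
  exact EReal.sub_le_sub le_rfl ((iInf₂_le f hfF).trans_eq hr)

/-- Subgradient selections of functions in `F` are optimal transport maps, and the restricted dual
problem has no gap for their targets. -/
lemma W2Sq_map_eq [IsFiniteMeasure μ] (hμ : secondMoment μ ≠ ⊤)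
    (hT : Measurable T) (hρ : secondMoment (μ.map T) ≠ ⊤) {F : Set (RSpace d → EReal)}
    (hF : ∀ f ∈ F, IsLscProperConvex f) {f : RSpace d → EReal} (hfF : f ∈ F)
    (hfT : ∀ᵐ x ∂μ, T x ∈ subdifferential f x) :
    (W2Sq μ (μ.map T) : EReal) = W2FSq F μ (μ.map T) ∧
    W2Sq μ (μ.map T) = ∫⁻ x, ‖x - T x‖ₑ ^ 2 / 2 ∂μ ∧
    W2FSq F μ (μ.map T) = (((∫ x, ‖x‖ ^ 2 ∂μ) / 2 + (∫ x, ‖x‖ ^ 2 ∂μ.map T) / 2 -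
      (∫ x, (f x).toReal ∂μ + ∫ y, (conjugate f y).toReal ∂μ.map T) : ℝ) : EReal) := by
  obtain ⟨h1, i1, h2, i2, e⟩ :=
    (hF f hfF).integrable_of_mem_subdifferential hμ hT hρ hfT
  have hprod : Measurable fun x => (x, T x) := measurable_id.prodMk hT
  have hπ := map_prodMk_mem_couplings (μ := μ) hT
  have hle := le_W2FSq hfF hμ hρ (dualObjective_eq_integral (hF f hfF) h1 i1 h2 i2)
  have hcost : ((∫⁻ x, ‖x - T x‖ₑ ^ 2 / 2 ∂μ : ℝ≥0∞) : EReal) =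
      (((∫ x, ‖x‖ ^ 2 ∂μ) / 2 + (∫ x, ‖x‖ ^ 2 ∂μ.map T) / 2 -
      (∫ x, (f x).toReal ∂μ + ∫ y, (conjugate f y).toReal ∂μ.map T) : ℝ) : EReal) := by
    have h := lintegral_cost_of_mem_couplings hπ hμ hρ
    rw [integral_map hprod.aemeasurable (by fun_prop), lintegral_map (by fun_prop) hprod] at h
    rw [e, ← h]
  have hup : W2Sq μ (μ.map T) ≤ ∫⁻ x, ‖x - T x‖ₑ ^ 2 / 2 ∂μ := by
    refine (iInf₂_le _ hπ).trans_eq ?_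
    rw [lintegral_map (by fun_prop) hprod]
  have hup' := EReal.coe_ennreal_le_coe_ennreal_iff.2 hup
  -- This closes the cycle: dual value at `f` ≤ `W2FSq` ≤ `W2Sq` ≤ cost of `T` = dual value at `f`.
  have hweak := W2FSq_le_W2Sq hF hμ hρ
  rw [← hcost] at hle ⊢
  have heq := le_antisymm hweak (hup'.trans hle)
  refine ⟨heq.symm, ?_, le_antisymm (hweak.trans hup') hle⟩
  exact EReal.coe_ennreal_eq_coe_ennreal_iff.1 (le_antisymm hup' (hle.trans hweak))

end Transport

/-! ### Square roots and `L²` inequalities in `ℝ≥0∞` -/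

section Sqrt

lemma esqrt_mono {a b : ℝ≥0∞} (h : a ≤ b) : esqrt a ≤ esqrt b :=
  ENNReal.rpow_le_rpow h (by norm_num)

lemma esqrt_mul (a b : ℝ≥0∞) : esqrt (a * b) = esqrt a * esqrt b :=
  ENNReal.mul_rpow_of_nonneg _ _ (by norm_num)

lemma esqrt_ne_top {a : ℝ≥0∞} (h : a ≠ ⊤) : esqrt a ≠ ⊤ :=
  ENNReal.rpow_ne_top_of_nonneg (by norm_num) h

lemma W2_eq_iInf (μ ν : Measure (RSpace d)) :
    W2 μ ν = ⨅ π ∈ couplings μ ν, esqrt (∫⁻ p, ‖p.1 - p.2‖ₑ ^ 2 / 2 ∂π) := by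
  have h (a : ℝ≥0∞) : esqrt a = ENNReal.orderIsoRpow (1 / 2) (by norm_num) a := rfl
  simp only [W2, W2Sq, h, OrderIso.map_iInf]

variable {α : Type*} [MeasurableSpace α] {π : Measure α}

lemma esqrt_lintegral_half (u : α → ℝ≥0∞) :
    esqrt (∫⁻ p, u p ^ 2 / 2 ∂π) = esqrt 2⁻¹ * esqrt (∫⁻ p, u p ^ 2 ∂π) := by
  simp only [ENNReal.div_eq_inv_mul]
  rw [lintegral_const_mul' _ _ (by simp), esqrt_mul]

/-- Minkowski's inequality. -/
lemma esqrt_lintegral_add_sq_le {u v : α → ℝ≥0∞} (hu : AEMeasurable u π) (hv : AEMeasurable v π) :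
    esqrt (∫⁻ p, (u p + v p) ^ 2 ∂π) ≤
      esqrt (∫⁻ p, u p ^ 2 ∂π) + esqrt (∫⁻ p, v p ^ 2 ∂π) := by
  simpa [esqrt] using ENNReal.lintegral_Lp_add_le hu hv (p := 2) (by norm_num)

/-- The Cauchy-Schwarz inequality. -/
lemma lintegral_mul_le_esqrt {u v : α → ℝ≥0∞} (hu : AEMeasurable u π) (hv : AEMeasurable v π) :
    ∫⁻ p, u p * v p ∂π ≤ esqrt (∫⁻ p, u p ^ 2 ∂π) * esqrt (∫⁻ p, v p ^ 2 ∂π) := by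
  simpa [esqrt] using ENNReal.lintegral_mul_le_Lp_mul_Lq π
    (Real.holderConjugate_iff.2 ⟨by norm_num, by norm_num⟩ : Real.HolderConjugate 2 2) hu hv

end Sqrt

/-! ### Gluing and the triangle inequality -/

/-- Composing a transport map with a coupling (gluing along a map). -/
lemma exists_glued_measure {μ ν : Measure (RSpace d)} [IsFiniteMeasure μ] {T : RSpace d → RSpace d}
    (hT : Measurable T) {π : Measure (RSpace d × RSpace d)} (hπ : π ∈ couplings (μ.map T) ν) :
    ∃ γ ∈ couplings μ ν, γ.map (fun p => (T p.1, p.2)) = π := by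
  obtain ⟨h1, h2⟩ := hπ
  have hfin : IsFiniteMeasure π := by
    have : IsFiniteMeasure (π.map Prod.fst) := h1 ▸ inferInstance
    exact Measure.isFiniteMeasure_of_map measurable_fst.aemeasurable
  have hm : Measurable fun p : RSpace d × RSpace d => (T p.1, p.2) := by fun_prop
  -- Given `x`, draw the second coordinate from the conditional law of `π` at `T x`.
  have hmap : (μ.compProd (π.condKernel.comap T hT)).map (fun p => (T p.1, p.2)) = π := by
    conv_rhs => rw [← π.disintegrate π.condKernel]
    ext s hs
    rw [Measure.map_apply hm hs, Measure.compProd_apply (hm hs), Measure.compProd_apply hs,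
      Measure.fst, h1, lintegral_map (ProbabilityTheory.Kernel.measurable_kernel_prodMk_left hs) hT]
    rfl
  refine ⟨_, ⟨Measure.fst_compProd _ _, ?_⟩, hmap⟩
  exact (Measure.map_map measurable_snd hm).symm.trans ((congrArg _ hmap).trans h2)

/-- The triangle inequality through the image of a transport map. -/
lemma W2_le_esqrt_add_W2_map {μ ν : Measure (RSpace d)} [IsFiniteMeasure μ]
    {T : RSpace d → RSpace d} (hT : Measurable T) :
    W2 μ ν ≤ esqrt (∫⁻ x, ‖x - T x‖ₑ ^ 2 / 2 ∂μ) + W2 (μ.map T) ν := by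
  rw [← tsub_le_iff_left, W2_eq_iInf (μ.map T)]
  refine le_iInf₂ fun π hπ => ?_
  rw [tsub_le_iff_left]
  obtain ⟨γ, hγ, hγπ⟩ := exists_glued_measure hT hπ
  have hm : Measurable fun p : RSpace d × RSpace d => (T p.1, p.2) := by fun_prop
  have e1 : ∫⁻ x, ‖x - T x‖ₑ ^ 2 / 2 ∂μ = ∫⁻ p, ‖p.1 - T p.1‖ₑ ^ 2 / 2 ∂γ := by
    conv_lhs => rw [← hγ.1]
    rw [lintegral_map (by fun_prop) measurable_fst]
  have e2 : ∫⁻ p, ‖p.1 - p.2‖ₑ ^ 2 / 2 ∂π = ∫⁻ p, ‖T p.1 - p.2‖ₑ ^ 2 / 2 ∂γ := by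
    rw [← hγπ, lintegral_map (by fun_prop) hm]
  calc W2 μ ν ≤ esqrt (∫⁻ p, ‖p.1 - p.2‖ₑ ^ 2 / 2 ∂γ) := esqrt_mono (iInf₂_le γ hγ)
    _ ≤ esqrt 2⁻¹ * esqrt (∫⁻ p, (‖p.1 - T p.1‖ₑ + ‖T p.1 - p.2‖ₑ) ^ 2 ∂γ) := by
      rw [esqrt_lintegral_half]
      gcongr
      refine esqrt_mono (lintegral_mono fun p => ?_)
      gcongr
      simpa using enorm_add_le (p.1 - T p.1) (T p.1 - p.2)
    _ ≤ esqrt 2⁻¹ * (esqrt (∫⁻ p, ‖p.1 - T p.1‖ₑ ^ 2 ∂γ) +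
        esqrt (∫⁻ p, ‖T p.1 - p.2‖ₑ ^ 2 ∂γ)) := by
      gcongr
      exact esqrt_lintegral_add_sq_le (by fun_prop) (by fun_prop)
    _ = _ := by rw [e1, e2, esqrt_lintegral_half, esqrt_lintegral_half, mul_add]

/-! ### Stability of the dual value in the target -/

/-- The Lipschitz-type estimate integrated against a coupling. -/
lemma lintegral_trapezoid_le (c₁ c₂ : ℝ≥0) {ρ ν : Measure (RSpace d)} [IsProbabilityMeasure ν]
    {π : Measure (RSpace d × RSpace d)} (hπ : π ∈ couplings ρ ν) :
    ∫⁻ p, ((c₁ : ℝ≥0∞) / 2 * (‖p.1‖ₑ + ‖p.2‖ₑ) + c₂) * ‖p.1 - p.2‖ₑ ∂π ≤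
      errorConst c₁ c₂ ν ρ * esqrt (∫⁻ p, ‖p.1 - p.2‖ₑ ^ 2 / 2 ∂π) := by
  have hprob : ∫⁻ _, 1 ∂π = 1 := by
    have h := measure_univ (μ := ν)
    rw [← hπ.2, Measure.map_apply measurable_snd MeasurableSet.univ, Set.preimage_univ] at h
    rw [lintegral_one, h]
  have e1 : ∫⁻ p, ‖p.1‖ₑ ^ 2 ∂π = secondMoment ρ := by
    rw [← hπ.1, secondMoment, lintegral_map (by fun_prop) measurable_fst]
  have e2 : ∫⁻ p, ‖p.2‖ₑ ^ 2 ∂π = secondMoment ν := by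
    rw [← hπ.2, secondMoment, lintegral_map (by fun_prop) measurable_snd]
  -- The `√2` in `errorConst` compensates the factor `½` in the cost.
  have hsqrt : esqrt 2 * esqrt 2⁻¹ = 1 := by
    rw [← esqrt_mul, ENNReal.mul_inv_cancel (by simp) (by simp), esqrt, ENNReal.one_rpow]
  have i1 := lintegral_mul_le_esqrt (π := π) (u := fun p => ‖p.1‖ₑ)
    (v := fun p => ‖p.1 - p.2‖ₑ) (by fun_prop) (by fun_prop)
  have i2 := lintegral_mul_le_esqrt (π := π) (u := fun p => ‖p.2‖ₑ)
    (v := fun p => ‖p.1 - p.2‖ₑ) (by fun_prop) (by fun_prop)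
  have i3 := lintegral_mul_le_esqrt (π := π) (u := fun _ => 1)
    (v := fun p => ‖p.1 - p.2‖ₑ) (by fun_prop) (by fun_prop)
  simp only [one_pow, hprob, one_mul] at i3
  rw [e1] at i1
  rw [e2] at i2
  set S := esqrt (∫⁻ p, ‖p.1 - p.2‖ₑ ^ 2 ∂π)
  have h1 : esqrt 1 = 1 := ENNReal.one_rpow _
  rw [h1, one_mul] at i3
  calc _ = (c₁ : ℝ≥0∞) / 2 * (∫⁻ p, ‖p.1‖ₑ * ‖p.1 - p.2‖ₑ ∂π + ∫⁻ p, ‖p.2‖ₑ * ‖p.1 - p.2‖ₑ ∂π) +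
        c₂ * ∫⁻ p, ‖p.1 - p.2‖ₑ ∂π := by
        rw [← lintegral_add_left (by fun_prop), ← lintegral_const_mul _ (by fun_prop),
          ← lintegral_const_mul _ (by fun_prop), ← lintegral_add_left (by fun_prop)]
        simp only [add_mul, mul_assoc]
    _ ≤ (c₁ : ℝ≥0∞) / 2 * (esqrt (secondMoment ρ) * S + esqrt (secondMoment ν) * S) + c₂ * S := by
        gcongr
    _ = (esqrt 2 * esqrt 2⁻¹) * (((c₁ : ℝ≥0∞) / 2 *
        (esqrt (secondMoment ν) + esqrt (secondMoment ρ)) + c₂) * S) := by rw [hsqrt]; ring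
    _ = _ := by rw [esqrt_lintegral_half, errorConst]; ring

lemma errorConst_ne_top (c₁ c₂ : ℝ≥0) {ν ρ : Measure (RSpace d)} (hν : secondMoment ν ≠ ⊤)
    (hρ : secondMoment ρ ≠ ⊤) : errorConst c₁ c₂ ν ρ ≠ ⊤ := by
  refine ENNReal.mul_ne_top (esqrt_ne_top (by simp)) (ENNReal.add_ne_top.2
    ⟨ENNReal.mul_ne_top (ENNReal.div_ne_top (by simp) (by simp)) (ENNReal.add_ne_top.2
      ⟨esqrt_ne_top hν, esqrt_ne_top hρ⟩), by simp⟩)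

lemma le_mul_W2 {ρ ν : Measure (RSpace d)} [IsProbabilityMeasure ρ] [IsProbabilityMeasure ν]
    {a c : ℝ≥0∞} (hc : c ≠ ⊤)
    (h : ∀ π ∈ couplings ρ ν, a ≤ c * esqrt (∫⁻ p, ‖p.1 - p.2‖ₑ ^ 2 / 2 ∂π)) :
    a ≤ c * W2 ρ ν := by
  rcases eq_or_ne c 0 with rfl | hc0
  -- For `c = 0` the existence of a coupling gives `a = 0`; the product serves.
  · simpa using h (ρ.prod ν) ⟨by simp [Measure.map_fst_prod], by simp [Measure.map_snd_prod]⟩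
  · rw [W2_eq_iInf, ENNReal.mul_iInf_of_ne hc0 hc]
    simp only [ENNReal.mul_iInf_of_ne hc0 hc]
    exact le_iInf₂ h

section Growth

variable {f : RSpace d → EReal} {c₁ c₂ : ℝ≥0}

lemma IsLscProperConvex.conjugate_ne_top_of_subdifferential (hf : IsLscProperConvex f)
    (h : ∀ x : RSpace d, ∃ g ∈ subdifferential (conjugate f) x, ‖g - x‖ ≤ c₁ * ‖x‖ + c₂)
    (x : RSpace d) : conjugate f x ≠ ⊤ := by
  obtain ⟨g, hg, -⟩ := h x
  exact ne_top_of_mem_subdifferential hf.exists_conjugate_ne_top hg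

lemma IsLscProperConvex.half_sq_sub_conjugate_le (hf : IsLscProperConvex f)
    (h : ∀ x : RSpace d, ∃ g ∈ subdifferential (conjugate f) x, ‖g - x‖ ≤ c₁ * ‖x‖ + c₂)
    (x y : RSpace d) :
    (‖x‖ ^ 2 / 2 - (conjugate f x).toReal) - (‖y‖ ^ 2 / 2 - (conjugate f y).toReal)
      ≤ (c₁ / 2 * (‖x‖ + ‖y‖) + c₂) * ‖x - y‖ := by
  refine half_sq_sub_le (f := fun x => (conjugate f x).toReal) c₁.2 (fun x => ?_) x y
  obtain ⟨g, hg, hgn⟩ := h x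
  refine ⟨g, fun z => ?_, hgn⟩
  have hz := hg z
  have hne := hf.conjugate_ne_top_of_subdifferential h
  rwa [← EReal.coe_toReal (hne x) (hf.conjugate_ne_bot x),
    ← EReal.coe_toReal (hne z) (hf.conjugate_ne_bot z), ← EReal.coe_add,
    EReal.coe_le_coe_iff] at hz

/-- Comparing with the origin in both directions gives at most quadratic growth. -/
lemma IsLscProperConvex.integrable_conjugate (hf : IsLscProperConvex f)
    (h : ∀ x : RSpace d, ∃ g ∈ subdifferential (conjugate f) x, ‖g - x‖ ≤ c₁ * ‖x‖ + c₂)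
    {ν : Measure (RSpace d)} [IsFiniteMeasure ν] (hν : secondMoment ν ≠ ⊤) :
    Integrable (fun y => (conjugate f y).toReal) ν := by
  have hsq := integrable_norm_sq hν
  refine (((hsq.div_const 2).add (integrable_const |(conjugate f 0).toReal|)).add
    ((hsq.const_mul ((c₁ : ℝ) / 2)).add ((integrable_norm hν).const_mul (c₂ : ℝ)))).mono'
    hf.lowerSemicontinuous_conjugate.measurable.ereal_toReal.aestronglyMeasurable
    (Filter.Eventually.of_forall fun x => ?_)
  have h1 := hf.half_sq_sub_conjugate_le h x 0
  have h2 := hf.half_sq_sub_conjugate_le h 0 x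
  simp only [norm_zero, sub_zero, zero_sub, norm_neg, Pi.add_apply, Real.norm_eq_abs] at h1 h2 ⊢
  rw [abs_le]
  have h3 := abs_le.1 (le_refl |(conjugate f 0).toReal|)
  have h4 : 0 ≤ ‖x‖ ^ 2 := by positivity
  constructor <;> nlinarith

end Growth

/-- Replacing the target of a subgradient transport by another measure changes the restricted dual
value at most by the error constant times the distance of the targets. -/
lemma W2FSq_map_le {μ ν : Measure (RSpace d)} [IsProbabilityMeasure μ] [IsProbabilityMeasure ν]
    (hμ : secondMoment μ ≠ ⊤) (hν : secondMoment ν ≠ ⊤) {T : RSpace d → RSpace d}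
    (hT : Measurable T) (hρ : secondMoment (μ.map T) ≠ ⊤) {F : Set (RSpace d → EReal)}
    (hF : ∀ f ∈ F, IsLscProperConvex f) {f : RSpace d → EReal} (hfF : f ∈ F)
    (hfT : ∀ᵐ x ∂μ, T x ∈ subdifferential f x) {c₁ c₂ : ℝ≥0}
    (h : ∀ x : RSpace d, ∃ g ∈ subdifferential (conjugate f) x, ‖g - x‖ ≤ c₁ * ‖x‖ + c₂) :
    W2FSq F μ (μ.map T) ≤
      W2FSq F μ ν + ((errorConst c₁ c₂ ν (μ.map T) * W2 (μ.map T) ν : ℝ≥0∞) : EReal) := by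
  have := Measure.isProbabilityMeasure_map (μ := μ) hT.aemeasurable
  obtain ⟨h1, i1, -, i2, -⟩ :=
    (hF f hfF).integrable_of_mem_subdifferential hμ hT hρ hfT
  have i3 := (hF f hfF).integrable_conjugate h hν
  have h3 := Filter.Eventually.of_forall (f := ae ν)
    ((hF f hfF).conjugate_ne_top_of_subdifferential h)
  have hle := le_W2FSq hfF hμ hν (dualObjective_eq_integral (hF f hfF) h1 i1 h3 i3)
  rw [(W2Sq_map_eq hμ hT hρ hF hfF hfT).2.2]
  set ρ := μ.map T
  have j2 := ((integrable_norm_sq hρ).div_const 2).sub i2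
  have j3 := ((integrable_norm_sq hν).div_const 2).sub i3
  have e2 := integral_sub ((integrable_norm_sq hρ).div_const 2) i2
  have e3 := integral_sub ((integrable_norm_sq hν).div_const 2) i3
  rw [integral_div] at e2 e3
  have hdiff : ENNReal.ofReal (∫ x, (‖x‖ ^ 2 / 2 - (conjugate f x).toReal) ∂ρ -
      ∫ x, (‖x‖ ^ 2 / 2 - (conjugate f x).toReal) ∂ν) ≤ errorConst c₁ c₂ ν ρ * W2 ρ ν := by
    refine le_mul_W2 (errorConst_ne_top c₁ c₂ hν hρ) fun π hπ => ?_
    refine le_trans ?_ (lintegral_trapezoid_le c₁ c₂ hπ)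
    obtain ⟨k2, l2⟩ := integral_fst_of_mem_couplings hπ j2
    obtain ⟨k3, l3⟩ := integral_snd_of_mem_couplings hπ j3
    simp only [Pi.sub_apply] at l2 l3 k2 k3
    rw [← l2, ← l3, ← integral_sub k2 k3]
    -- Passing to the positive part lets `ENNReal.ofReal` move inside the integral.
    refine (ENNReal.ofReal_le_ofReal (integral_mono (k2.sub k3) (k2.sub k3).pos_part
      fun p => le_max_left _ _)).trans ?_
    rw [ofReal_integral_eq_lintegral_ofReal (k2.sub k3).pos_part
      (Filter.Eventually.of_forall fun p => le_max_right _ _)]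
    refine lintegral_mono fun p => ?_
    have hp := (hF f hfF).half_sq_sub_conjugate_le h p.1 p.2
    have hK : 0 ≤ (c₁ / 2 * (‖p.1‖ + ‖p.2‖) + c₂) * ‖p.1 - p.2‖ := by positivity
    refine (ENNReal.ofReal_le_ofReal (max_le hp hK)).trans_eq ?_
    rw [ENNReal.ofReal_mul (by positivity), ENNReal.ofReal_add (by positivity) (by positivity),
      ENNReal.ofReal_mul (by positivity), ENNReal.ofReal_add (by positivity) (by positivity),
      ENNReal.ofReal_div_of_pos two_pos, ENNReal.ofReal_ofNat, ENNReal.ofReal_coe_nnreal,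
      ENNReal.ofReal_coe_nnreal, ofReal_norm, ofReal_norm, ofReal_norm]
  refine le_trans ?_ (add_le_add hle (EReal.coe_ennreal_le_coe_ennreal_iff.2 hdiff))
  rw [EReal.coe_ennreal_ofReal, ← EReal.coe_add, EReal.coe_le_coe_iff]
  have := le_max_left (∫ x, (‖x‖ ^ 2 / 2 - (conjugate f x).toReal) ∂ρ -
      ∫ x, (‖x‖ ^ 2 / 2 - (conjugate f x).toReal) ∂ν) 0
  linarith

end

/-! ### Conclusion -/

theorem theorem2 (d : ℕ) (F : Set (RSpace d → EReal)) (hF : ∀ f ∈ F, IsLscProperConvex f)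
    (μ ν : Measure (RSpace d)) [IsProbabilityMeasure μ] [IsProbabilityMeasure ν]
    (hμ : secondMoment μ ≠ ⊤) (hν : secondMoment ν ≠ ⊤) :
    -- (i)
    (ν ∈ gradPushforward F μ →
      (W2Sq μ ν : EReal) = W2FSq F μ ν ∧ W2 μ ν = W2F F μ ν) ∧
    -- (ii), lower bound
    (W2FSq F μ ν ≤ (W2Sq μ ν : EReal) ∧ W2F F μ ν ≤ W2 μ ν) ∧
    -- (ii), upper bound
    (∀ c₁ c₂ : ℝ≥0,
      (∀ f ∈ F, ∀ x : RSpace d, ∃ g ∈ subdifferential (conjugate f) x,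
        ‖g - x‖ ≤ c₁ * ‖x‖ + c₂) →
      ∀ ρ ∈ W2Proj ν (gradPushforward F μ), secondMoment ρ ≠ ⊤ →
        0 ≤ W2FSq F μ ν + ((errorConst c₁ c₂ ν ρ * W2 ρ ν : ℝ≥0∞) : EReal) ∧
        W2 μ ν ≤
          esqrt (W2FSq F μ ν + ((errorConst c₁ c₂ ν ρ * W2 ρ ν : ℝ≥0∞) : EReal)).toENNReal
            + W2 ρ ν) := by
  refine ⟨?_, ?_, ?_⟩
  · rintro ⟨f, hfF, T, hT, hfT, rfl⟩
    have h := (W2Sq_map_eq hμ hT hν hF hfF hfT).1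
    refine ⟨h, ?_⟩
    rw [W2F, ← h, EReal.toENNReal_coe, W2]
  · have h := W2FSq_le_W2Sq hF hμ hν
    refine ⟨h, esqrt_mono ?_⟩
    simpa only [EReal.toENNReal_coe] using EReal.toENNReal_le_toENNReal h
  · rintro c₁ c₂ hc ρ ⟨⟨f, hfF, T, hT, hfT, rfl⟩, -⟩ hρ
    obtain ⟨h1, h2, -⟩ := W2Sq_map_eq hμ hT hρ hF hfF hfT
    have hle := W2FSq_map_le hμ hν hT hρ hF hfF hfT (hc f hfF)
    rw [← h1] at hle
    refine ⟨(EReal.coe_ennreal_nonneg _).trans hle, ?_⟩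
    -- The first term is the cost of `T`, which equals `W2Sq μ (μ.map T)` by optimality.
    refine (W2_le_esqrt_add_W2_map hT).trans ?_
    gcongr
    rw [← h2]
    refine esqrt_mono ?_
    simpa only [EReal.toENNReal_coe] using EReal.toENNReal_le_toENNReal hle
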